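/- For a permutation $\pi=\pi_1\pi_2\cdots\pi_n$ of $\{1,\dots,n\}$ (the set of which is $\mathfrak S_n$), let $\mathrm{des}(\pi)=|\{1\le i\le n-1:\pi_i>\pi_{i+1}\}|$, $\mathrm{exc}(\pi)=|\{1\le i\le n-1:\pi_i>i\}|$ and $\mathrm{maj}(\pi)=\sum_{1\le i\le n-1,\ \pi_i>\pi_{i+1}} i$. Define the Eulerian polynomials and the $(\mathrm{maj},\mathrm{exc})$-Eulerian polynomials by $$A_n(t)=\sum_{\pi\in\mathfrak S_n}t^{\mathrm{des}(\pi)},\qquad A_n(t,q)=\sum_{\pi\in\mathfrak S_n}t^{\mathrm{exc}(\pi)}q^{\mathrm{maj}(\pi)-\mathrm{exc}(\pi)}.$$ Then for every $n\ge 1$, $$A_n(t,-1)=\begin{cases}(1+t)^m A_m(t), & \text{if } n=2m,\\ (1+t)^m A_{m+1}(t), & \text{if } n=2m+1.\end{cases}$$ -/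

import Mathlib

/-! Permutations of `{1, …, n}` are modelled as `Equiv.Perm (Fin n)`: the position `i : Fin n`
stands for the position `i + 1` of the one-line notation. -/

namespace SignBalance

open Polynomial

/-- The set of descents of `π`: positions `i`, other than the last one, with
`π i > π (i + 1)`. -/
def descents {n : ℕ} (π : Equiv.Perm (Fin n)) : Finset (Fin n) :=
  Finset.univ.filter fun i => ∃ h : (i : ℕ) + 1 < n, π ⟨(i : ℕ) + 1, h⟩ < π i

/-- The number of descents of `π`. -/
def des {n : ℕ} (π : Equiv.Perm (Fin n)) : ℕ := (descents π).card

/-- The number of excedances of `π` (the last position is never an excedance). -/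
def exc {n : ℕ} (π : Equiv.Perm (Fin n)) : ℕ :=
  (Finset.univ.filter fun i => i < π i).card

/-- The major index of `π`: the sum of its descents, where the positions are counted from `1`. -/
def maj {n : ℕ} (π : Equiv.Perm (Fin n)) : ℕ := ∑ i ∈ descents π, ((i : ℕ) + 1)

/-- At or after every excedance there is a descent. -/
theorem exists_descent_of_exc {n : ℕ} (π : Equiv.Perm (Fin n)) (i : Fin n) (hi : i < π i) :
    ∃ j ∈ descents π, i ≤ j := by
  by_contra! hno
  have key : ∀ k : ℕ, ∀ h : (i : ℕ) + k < n, (π i : ℕ) + k ≤ (π ⟨(i : ℕ) + k, h⟩ : ℕ) := by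
    intro k
    induction k with
    | zero => intro h; exact le_refl _
    | succ k ih =>
      intro h
      have hk : (i : ℕ) + k < n := by omega
      have h1 := ih hk
      have h2 : ¬ π ⟨(i : ℕ) + k + 1, h⟩ < π ⟨(i : ℕ) + k, hk⟩ := by
        intro hlt
        have hmem : (⟨(i : ℕ) + k, hk⟩ : Fin n) ∈ descents π := by
          simp only [descents, Finset.mem_filter, Finset.mem_univ, true_and]
          exact ⟨h, hlt⟩
        have h3 := hno _ hmem
        rw [Fin.lt_def] at h3
        simp only at h3
        omega
      have h4 : π ⟨(i : ℕ) + k + 1, h⟩ ≠ π ⟨(i : ℕ) + k, hk⟩ := by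
        intro he
        have h5 := congrArg Fin.val (π.injective he)
        simp only at h5
        omega
      have h6 : (π ⟨(i : ℕ) + k, hk⟩ : ℕ) < (π ⟨(i : ℕ) + k + 1, h⟩ : ℕ) :=
        lt_of_le_of_ne (not_lt.mp h2) (fun he => h4 (Fin.ext he.symm))
      change (π i : ℕ) + (k + 1) ≤ (π ⟨(i : ℕ) + k + 1, h⟩ : ℕ)
      omega
  have hin := i.isLt
  have h := key (n - 1 - i) (by omega)
  have h' := (π ⟨(i : ℕ) + (n - 1 - i), by omega⟩).isLt
  rw [Fin.lt_def] at hi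
  omega

/-- The number of excedances never exceeds the major index, so that the subtraction of natural
numbers in `qEulerian` is never truncated. -/
theorem exc_le_maj {n : ℕ} (π : Equiv.Perm (Fin n)) : exc π ≤ maj π := by
  rcases (descents π).eq_empty_or_nonempty with he | hne
  · have h0 : exc π = 0 := by
      rw [exc, Finset.card_eq_zero, Finset.filter_eq_empty_iff]
      intro i _ hi
      obtain ⟨j, hj, _⟩ := exists_descent_of_exc π i hi
      simp [he] at hj
    omega
  · have hd := (descents π).max'_mem hne
    set d := (descents π).max' hne
    have h1 : exc π ≤ (Finset.Iic d).card := by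
      apply Finset.card_le_card
      intro i hi
      obtain ⟨j, hj, hij⟩ := exists_descent_of_exc π i (Finset.mem_filter.mp hi).2
      exact Finset.mem_Iic.mpr (hij.trans ((descents π).le_max' j hj))
    have h2 : (d : ℕ) + 1 ≤ maj π :=
      Finset.single_le_sum (f := fun i : Fin n => (i : ℕ) + 1) (fun _ _ => Nat.zero_le _) hd
    rw [Fin.card_Iic] at h1
    omega

/-- The Eulerian polynomial `A_n(t) = ∑ t ^ des π`, as an element of `ℤ[t]`. -/
noncomputable def eulerian (n : ℕ) : ℤ[X] :=
  ∑ π : Equiv.Perm (Fin n), X ^ des π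

/-- The `(maj, exc)`-Eulerian polynomial `A_n(t, q) = ∑ t ^ exc π * q ^ (maj π - exc π)`, as an
element of `ℤ[q][t]`: the outer variable `X` is `t`, the inner one `C X` is `q`. -/
noncomputable def qEulerian (n : ℕ) : ℤ[X][X] :=
  ∑ π : Equiv.Perm (Fin n), X ^ exc π * C (X ^ (maj π - exc π))

/-- The specialization `A_n(t, c)` of `A_n(t, q)` at an integer `q = c`, an element of `ℤ[t]`. -/
noncomputable def qEulerianAt (n : ℕ) (c : ℤ) : ℤ[X] :=
  (qEulerian n).map (evalRingHom c)

end SignBalance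

namespace SignBalance

open Polynomial

/-! ### Equidistribution of descents and excedances -/

/-! At `q = -1` each `π` contributes `(-t) ^ exc π * (-1) ^ maj π`. The sign of `maj` sees only
descents at odd one-based positions, so this weight factors over the position pairs `{2a, 2a + 1}`
(zero-based), an unpaired last position contributing `1` (`neg_X_pow_exc_mul`).

Swapping the two values of a pair shows that only the symmetrization of each factor matters
(`sum_perm_prod_pairs_congr`). The symmetrization vanishes unless one value is `2a + 1`, so the
factor can be replaced by one supported on `π (2a + 1) = 2a + 1` (`pairWeight_symm`). What survives
is `(1 + t) ^ (n / 2)` times the excedance enumerator of the permutations of the even positions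
(`sum_fixing_odd`).

Finally `exc` and `des` are equidistributed: inserting a new maximum, into the word or into a cycle,
gives the same recurrence (`sum_perm_succ`). -/

/-- The excedance enumerator `∑ t ^ exc π`. -/
noncomputable def excPoly (n : ℕ) : ℤ[X] :=
  ∑ π : Equiv.Perm (Fin n), X ^ exc π

/-- Insert the new maximal value into `π` at position `p`. -/
def insertMax {n : ℕ} (p : Fin (n + 1)) (π : Equiv.Perm (Fin n)) : Equiv.Perm (Fin (n + 1)) :=
  ((finSuccEquiv' p).trans (Equiv.optionCongr π)).trans finSuccEquivLast.symm

@[simp]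
theorem insertMax_self {n : ℕ} (p : Fin (n + 1)) (π : Equiv.Perm (Fin n)) :
    insertMax p π p = Fin.last n := by
  simp [insertMax]

@[simp]
theorem insertMax_succAbove {n : ℕ} (p : Fin (n + 1)) (π : Equiv.Perm (Fin n)) (i : Fin n) :
    insertMax p π (p.succAbove i) = (π i).castSucc := by
  simp [insertMax]

@[simp]
theorem insertMax_last_castSucc {n : ℕ} (π : Equiv.Perm (Fin n)) (i : Fin n) :
    insertMax (Fin.last n) π i.castSucc = (π i).castSucc := by
  have h := insertMax_succAbove (Fin.last n) π i
  rwa [Fin.succAbove_last] at h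

theorem insertMax_injective {n : ℕ} (p : Fin (n + 1)) :
    Function.Injective (insertMax p : Equiv.Perm (Fin n) → Equiv.Perm (Fin (n + 1))) := by
  intro π ρ h
  ext i
  have h1 := congrArg (fun τ : Equiv.Perm (Fin (n + 1)) => τ (p.succAbove i)) h
  simp only [insertMax_succAbove] at h1
  rw [Fin.castSucc_injective n h1]

/-- The position `p` is recovered as the preimage of the maximum, and `(n + 1) * n! = (n + 1)!`. -/
theorem bijective_of_apply_eq_last {n : ℕ}
    (F : Fin (n + 1) → Equiv.Perm (Fin n) → Equiv.Perm (Fin (n + 1)))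
    (hF : ∀ p π, F p π p = Fin.last n) (hinj : ∀ p, Function.Injective (F p)) :
    Function.Bijective fun x : Fin (n + 1) × Equiv.Perm (Fin n) => F x.1 x.2 := by
  rw [Fintype.bijective_iff_injective_and_card]
  refine ⟨?_, by simp [Fintype.card_perm, Nat.factorial_succ]⟩
  rintro ⟨p, π⟩ ⟨r, ρ⟩ h
  simp only at h
  have hp : p = r := by
    apply (F p π).injective
    rw [hF, h, hF]
  subst hp
  rw [hinj p h]

/-- Summation over `𝔖_{n+1}` when the statistic `s` of the `n + 1` extensions of `π` stays the same
for those in a set of `1 + s π` positions, and grows by one for the others. -/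
theorem sum_perm_succ {n : ℕ}
    (F : Fin (n + 1) → Equiv.Perm (Fin n) → Equiv.Perm (Fin (n + 1)))
    (hF : ∀ p π, F p π p = Fin.last n) (hinj : ∀ p, Function.Injective (F p))
    (s : Equiv.Perm (Fin n) → ℕ) (s' : Equiv.Perm (Fin (n + 1)) → ℕ)
    (A : Equiv.Perm (Fin n) → Finset (Fin (n + 1))) (hA : ∀ π, (A π).card = s π + 1)
    (hs : ∀ p π, s' (F p π) = if p ∈ A π then s π else s π + 1) :
    ∑ π, (X : ℤ[X]) ^ s' π =
      (1 + (n : ℤ[X]) * X) * ∑ π, X ^ s π +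
        X * (1 - X) * derivative (∑ π, (X : ℤ[X]) ^ s π) := by
  rw [← (bijective_of_apply_eq_last F hF hinj).sum_comp, Fintype.sum_prod_type_right]
  rw [derivative_sum, Finset.mul_sum, Finset.mul_sum, ← Finset.sum_add_distrib]
  refine Finset.sum_congr rfl fun π _ => ?_
  have h1 : ∀ p, (X : ℤ[X]) ^ s' (F p π) =
      X ^ s π * X + if p ∈ A π then X ^ s π * (1 - X) else 0 := by
    intro p
    rw [hs]
    split_ifs <;> ring
  simp only [h1, Finset.sum_add_distrib, Finset.sum_ite_mem, Finset.univ_inter,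
    Finset.sum_const, Finset.card_univ, Fintype.card_fin, hA, nsmul_eq_mul]
  -- The derivative of `X ^ k` involves the truncated exponent `k - 1`, so `0` is treated apart.
  rcases s π with _ | k
  · simp
    ring
  · simp only [derivative_X_pow, Nat.add_sub_cancel, Nat.cast_add, Nat.cast_one, map_add, map_one,
      map_natCast]
    ring

/-! ### Descents under insertion of the maximum into the word -/

theorem self_mem_descents_insertMax {n : ℕ} (p : Fin (n + 1)) (π : Equiv.Perm (Fin n)) :
    p ∈ descents (insertMax p π) ↔ p ≠ Fin.last n := by
  simp only [descents, Finset.mem_filter, Finset.mem_univ, true_and, insertMax_self]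
  constructor
  · rintro ⟨h, -⟩ rfl
    simp at h
  · intro h
    have hp : (p : ℕ) + 1 < n + 1 := by
      have := Fin.val_lt_last h
      omega
    refine ⟨hp, lt_of_le_of_ne (Fin.le_last _) fun he => ?_⟩
    rw [← insertMax_self p π] at he
    have := congrArg Fin.val ((insertMax p π).injective he)
    simp at this

/-- Neighbours stay adjacent unless the maximum lands between them, which turns that step into an
ascent. -/
theorem succAbove_mem_descents_insertMax {n : ℕ} (p : Fin (n + 1)) (π : Equiv.Perm (Fin n))
    (i : Fin n) :
    p.succAbove i ∈ descents (insertMax p π) ↔ i ∈ descents π ∧ p ≠ i.succ := by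
  simp only [descents, Finset.mem_filter, Finset.mem_univ, true_and, insertMax_succAbove]
  by_cases hp : p = i.succ
  · subst hp
    simp only [ne_eq, not_true_eq_false, and_false, iff_false, not_exists]
    intro h hlt
    have he : (⟨((i.succ).succAbove i : ℕ) + 1, h⟩ : Fin (n + 1)) = i.succ := by
      ext
      simp
    rw [he, insertMax_self] at hlt
    exact absurd hlt (not_lt.mpr (Fin.le_last _))
  · have key : ∀ h : (i : ℕ) + 1 < n,
        (p.succAbove ⟨(i : ℕ) + 1, h⟩ : ℕ) = (p.succAbove i : ℕ) + 1 := by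
      intro h
      have hp' : (p : ℕ) ≠ i + 1 := fun h' => hp (Fin.ext (by simpa using h'))
      simp only [Fin.succAbove, Fin.lt_def, Fin.val_castSucc]
      split_ifs <;> simp <;> omega
    simp only [ne_eq, hp, not_false_eq_true, and_true]
    constructor
    · rintro ⟨h, hlt⟩
      have hi : (i : ℕ) + 1 < n := by
        have hp' : (p : ℕ) ≠ i + 1 := fun h' => hp (Fin.ext (by simpa using h'))
        have hp2 := p.isLt
        have hi2 := i.isLt
        simp only [Fin.succAbove, Fin.lt_def, Fin.val_castSucc] at h
        split_ifs at h <;> simp at h <;> omega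
      refine ⟨hi, ?_⟩
      have he : (⟨(p.succAbove i : ℕ) + 1, h⟩ : Fin (n + 1)) = p.succAbove ⟨(i : ℕ) + 1, hi⟩ :=
        Fin.ext (key hi).symm
      rw [he, insertMax_succAbove] at hlt
      exact hlt
    · rintro ⟨hi, hlt⟩
      have h : (p.succAbove i : ℕ) + 1 < n + 1 := by
        rw [← key hi]
        exact (p.succAbove ⟨(i : ℕ) + 1, hi⟩).isLt
      refine ⟨h, ?_⟩
      have he : (⟨(p.succAbove i : ℕ) + 1, h⟩ : Fin (n + 1)) = p.succAbove ⟨(i : ℕ) + 1, hi⟩ :=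
        Fin.ext (key hi).symm
      rw [he, insertMax_succAbove]
      exact hlt

/-- The positions at which inserting the maximal value creates no new descent. -/
def desNeutral {n : ℕ} (π : Equiv.Perm (Fin n)) : Finset (Fin (n + 1)) :=
  insert (Fin.last n) ((descents π).map (Fin.succEmb n))

theorem last_notMem_succ_descents {n : ℕ} (π : Equiv.Perm (Fin n)) :
    Fin.last n ∉ (descents π).map (Fin.succEmb n) := by
  simp only [Finset.mem_map, not_exists, not_and]
  intro i hi he
  obtain ⟨h, -⟩ := (Finset.mem_filter.mp hi).2
  have := congrArg Fin.val he
  simp at this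
  omega

theorem card_desNeutral {n : ℕ} (π : Equiv.Perm (Fin n)) :
    (desNeutral π).card = des π + 1 := by
  rw [desNeutral, Finset.card_insert_of_notMem (last_notMem_succ_descents π), Finset.card_map, des]

theorem card_eq_sum_ite {α : Type*} [Fintype α] [DecidableEq α] (s : Finset α) :
    s.card = ∑ i, if i ∈ s then 1 else 0 := by
  simp

/-- The maximum creates a descent at `p` unless it comes last, and destroys the descent that it
splits, if any. -/
theorem des_insertMax {n : ℕ} (p : Fin (n + 1)) (π : Equiv.Perm (Fin n)) :
    des (insertMax p π) = if p ∈ desNeutral π then des π else des π + 1 := by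
  have h1 : des (insertMax p π) = (if p = Fin.last n then 0 else 1) +
      ((descents π).filter fun i => p ≠ i.succ).card := by
    rw [des, card_eq_sum_ite, Fin.sum_univ_succAbove _ p, card_eq_sum_ite]
    simp only [self_mem_descents_insertMax, succAbove_mem_descents_insertMax, Finset.mem_filter,
      ne_eq, ite_not]
  rw [h1]
  by_cases hl : p = Fin.last n
  · have h2 : ((descents π).filter fun i => p ≠ i.succ) = descents π := by
      rw [Finset.filter_eq_self]
      rintro i hi rfl
      exact last_notMem_succ_descents π (hl ▸ Finset.mem_map_of_mem (Fin.succEmb n) hi)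
    rw [h2, if_pos hl, if_pos (by simp [desNeutral, hl]), des, zero_add]
  · rw [if_neg hl]
    by_cases hd : ∃ i ∈ descents π, p = i.succ
    · obtain ⟨i, hi, rfl⟩ := hd
      have h2 : ((descents π).filter fun j => i.succ ≠ j.succ) = (descents π).erase i := by
        ext j
        simp [and_comm, eq_comm]
      rw [h2, if_pos (by simp [desNeutral, hi]), Finset.card_erase_of_mem hi, des]
      have := Finset.card_pos.mpr ⟨i, hi⟩
      omega
    · have h2 : ((descents π).filter fun i => p ≠ i.succ) = descents π := by
        rw [Finset.filter_eq_self]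
        exact fun i hi he => hd ⟨i, hi, he⟩
      have h3 : p ∉ desNeutral π := by
        simp only [desNeutral, Finset.mem_insert, Finset.mem_map, Fin.coe_succEmb, not_or]
        exact ⟨hl, fun ⟨i, hi, he⟩ => hd ⟨i, hi, he.symm⟩⟩
      rw [h2, if_neg h3, des, add_comm]

theorem eulerian_succ (n : ℕ) :
    eulerian (n + 1) =
      (1 + (n : ℤ[X]) * X) * eulerian n + X * (1 - X) * derivative (eulerian n) :=
  sum_perm_succ insertMax insertMax_self insertMax_injective des des desNeutral card_desNeutral
    des_insertMax

/-! ### Excedances under insertion of the maximum into a cycle -/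

/-- Insert the new maximal value into the cycle of `π` through `p`, directly after `p`. -/
def insertCycle {n : ℕ} (p : Fin (n + 1)) (π : Equiv.Perm (Fin n)) : Equiv.Perm (Fin (n + 1)) :=
  insertMax (Fin.last n) π * Equiv.swap p (Fin.last n)

theorem insertCycle_self {n : ℕ} (p : Fin (n + 1)) (π : Equiv.Perm (Fin n)) :
    insertCycle p π p = Fin.last n := by
  simp [insertCycle]

theorem insertCycle_injective {n : ℕ} (p : Fin (n + 1)) :
    Function.Injective (insertCycle p : Equiv.Perm (Fin n) → Equiv.Perm (Fin (n + 1))) :=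
  fun _ _ h => insertMax_injective _ (mul_right_cancel h)

/-- The elements after which the maximal value can be inserted into a cycle without creating a new
excedance. -/
def excNeutral {n : ℕ} (π : Equiv.Perm (Fin n)) : Finset (Fin (n + 1)) :=
  insert (Fin.last n) ((Finset.univ.filter fun i => i < π i).map Fin.castSuccEmb)

theorem card_excNeutral {n : ℕ} (π : Equiv.Perm (Fin n)) :
    (excNeutral π).card = exc π + 1 := by
  rw [excNeutral, Finset.card_insert_of_notMem (by simp), Finset.card_map, exc]

theorem castSucc_lt_insertCycle {n : ℕ} (p : Fin (n + 1)) (π : Equiv.Perm (Fin n)) (i : Fin n) :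
    i.castSucc < insertCycle p π i.castSucc ↔ i.castSucc = p ∨ i < π i := by
  by_cases h : i.castSucc = p
  · subst h
    simp [insertCycle_self, Fin.castSucc_lt_last]
  · have h2 : insertCycle p π i.castSucc = (π i).castSucc := by
      rw [insertCycle, Equiv.Perm.mul_apply,
        Equiv.swap_apply_of_ne_of_ne h (Fin.castSucc_lt_last i).ne, insertMax_last_castSucc]
    simp [h2, h]

theorem exc_insertCycle {n : ℕ} (p : Fin (n + 1)) (π : Equiv.Perm (Fin n)) :
    exc (insertCycle p π) = if p ∈ excNeutral π then exc π else exc π + 1 := by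
  have h1 : exc (insertCycle p π) =
      (Finset.univ.filter fun i : Fin n => i.castSucc = p ∨ i < π i).card := by
    rw [exc, Finset.card_filter, Fin.sum_univ_castSucc, Finset.card_filter]
    simp [castSucc_lt_insertCycle, Fin.le_last]
  rw [h1, exc]
  induction p using Fin.lastCases with
  | last => simp [excNeutral, (Fin.castSucc_lt_last _).ne]
  | cast j =>
    by_cases hj : j < π j
    · rw [if_pos (by simp [excNeutral, hj])]
      congr 1
      ext i
      simp only [Finset.mem_filter, Finset.mem_univ, true_and, Fin.castSucc_inj, or_iff_right_iff_imp]
      rintro rfl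
      exact hj
    · rw [if_neg (by simp [excNeutral, hj, (Fin.castSucc_lt_last _).ne]),
        ← Finset.card_insert_of_notMem (a := j) (by simp [not_lt.mp hj])]
      congr 1
      ext i
      simp

theorem excPoly_succ (n : ℕ) :
    excPoly (n + 1) =
      (1 + (n : ℤ[X]) * X) * excPoly n + X * (1 - X) * derivative (excPoly n) :=
  sum_perm_succ insertCycle insertCycle_self insertCycle_injective exc exc excNeutral
    card_excNeutral exc_insertCycle

theorem excPoly_eq_eulerian (n : ℕ) : excPoly n = eulerian n := by
  induction n with
  | zero => simp [excPoly, eulerian, exc, des, descents]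
  | succ n ih => rw [excPoly_succ, eulerian_succ, ih]

/-! ### Pairing of consecutive positions -/

/-- The first position of the `a`-th pair of positions. -/
def fstPos {n : ℕ} (a : Fin (n / 2)) : Fin n := ⟨2 * a, by omega⟩

/-- The second position of the `a`-th pair of positions. -/
def sndPos {n : ℕ} (a : Fin (n / 2)) : Fin n := ⟨2 * a + 1, by omega⟩

theorem prod_range_two_mul {R : Type*} [CommMonoid R] (f : ℕ → R) (k : ℕ) :
    ∏ i ∈ Finset.range (2 * k), f i = ∏ a ∈ Finset.range k, f (2 * a) * f (2 * a + 1) := by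
  induction k with
  | zero => simp
  | succ k ih =>
    rw [Nat.mul_succ, Finset.prod_range_succ, Finset.prod_range_succ, ih, Finset.prod_range_succ,
      mul_assoc]

theorem prod_eq_prod_pairs {R : Type*} [CommMonoid R] {n : ℕ} (f : Fin n → R)
    (hf : ∀ i : Fin n, (i : ℕ) + 1 = n → f i = 1) :
    ∏ i, f i = ∏ a : Fin (n / 2), f (fstPos a) * f (sndPos a) := by
  set g : ℕ → R := fun i => if h : i < n then f ⟨i, h⟩ else 1 with hg
  have h1 : ∏ i, f i = ∏ i ∈ Finset.range n, g i := by
    rw [Finset.prod_range]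
    simp [hg]
  have h2 : ∏ a : Fin (n / 2), f (fstPos a) * f (sndPos a) =
      ∏ a ∈ Finset.range (n / 2), g (2 * a) * g (2 * a + 1) := by
    rw [Finset.prod_range]
    refine Finset.prod_congr rfl fun a _ => ?_
    have := a.isLt
    simp only [hg]
    rw [dif_pos (by omega), dif_pos (by omega)]
    rfl
  rw [h1, h2, ← prod_range_two_mul]
  rcases Nat.even_or_odd' n with ⟨k, hk | hk⟩
  · congr 2
    omega
  · have h3 : Finset.range n = Finset.range (2 * (n / 2) + 1) := by
      congr 1
      omega
    rw [h3, Finset.prod_range_succ]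
    have h4 : g (2 * (n / 2)) = 1 := by
      simp only [hg]
      split_ifs with h
      · exact hf _ (by simp only; omega)
      · rfl
    rw [h4, mul_one]

theorem fstPos_injective {n : ℕ} : Function.Injective (fstPos : Fin (n / 2) → Fin n) := by
  intro a b h
  simp only [fstPos, Fin.mk.injEq] at h
  omega

theorem sndPos_injective {n : ℕ} : Function.Injective (sndPos : Fin (n / 2) → Fin n) := by
  intro a b h
  simp only [sndPos, Fin.mk.injEq] at h
  omega

theorem fstPos_ne_sndPos {n : ℕ} (a b : Fin (n / 2)) : (fstPos a : Fin n) ≠ sndPos b := by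
  intro h
  simp only [fstPos, sndPos, Fin.mk.injEq] at h
  omega

/-- A sum over permutations of products over the pairs of positions only depends on the
symmetrizations of the factors. -/
theorem sum_perm_prod_pairs_congr {n : ℕ} (f g : Fin (n / 2) → Fin n → Fin n → ℤ[X])
    (hfg : ∀ a x y, x ≠ y → f a x y + f a y x = g a x y + g a y x) :
    ∑ π : Equiv.Perm (Fin n), ∏ a, f a (π (fstPos a)) (π (sndPos a)) =
      ∑ π : Equiv.Perm (Fin n), ∏ a, g a (π (fstPos a)) (π (sndPos a)) := by
  -- The factors are exchanged one pair at a time; `S` collects the pairs already treated.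
  have key : ∀ S : Finset (Fin (n / 2)),
      ∑ π : Equiv.Perm (Fin n), ∏ a, f a (π (fstPos a)) (π (sndPos a)) =
      ∑ π : Equiv.Perm (Fin n),
        ∏ a, (if a ∈ S then g a else f a) (π (fstPos a)) (π (sndPos a)) := by
    intro S
    induction S using Finset.induction_on with
    | empty => simp
    | insert b S hb ih =>
      rw [ih, ← sub_eq_zero, ← Finset.sum_sub_distrib]
      set Φ : Equiv.Perm (Fin n) → ℤ[X] := fun π =>
        (f b (π (fstPos b)) (π (sndPos b)) - g b (π (fstPos b)) (π (sndPos b))) *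
          ∏ a ∈ Finset.univ.erase b,
            (if a ∈ S then g a else f a) (π (fstPos a)) (π (sndPos a)) with hΦ
      have h1 : ∀ π : Equiv.Perm (Fin n),
          ∏ a, (if a ∈ S then g a else f a) (π (fstPos a)) (π (sndPos a)) -
            ∏ a, (if a ∈ insert b S then g a else f a) (π (fstPos a)) (π (sndPos a)) = Φ π := by
        intro π
        rw [← Finset.mul_prod_erase _ _ (Finset.mem_univ b),
          ← Finset.mul_prod_erase Finset.univ
            (fun a => (if a ∈ insert b S then g a else f a) (π (fstPos a)) (π (sndPos a)))
            (Finset.mem_univ b)]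
        have h2 : ∏ a ∈ Finset.univ.erase b,
            (if a ∈ insert b S then g a else f a) (π (fstPos a)) (π (sndPos a)) =
            ∏ a ∈ Finset.univ.erase b,
            (if a ∈ S then g a else f a) (π (fstPos a)) (π (sndPos a)) := by
          refine Finset.prod_congr rfl fun a ha => ?_
          simp [Finset.mem_insert, (Finset.mem_erase.mp ha).1]
        rw [h2, if_neg hb, if_pos (Finset.mem_insert_self b S), ← sub_mul]
      simp only [h1]
      -- Swapping the values of pair `b` leaves the other factors alone and, by `hfg`, negates `f b
      -- - g b`; hence the sum of `Φ` equals its own negative.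
      have h3 : ∀ π, Φ (π * Equiv.swap (fstPos b) (sndPos b)) = -Φ π := by
        intro π
        have h4 : ∏ a ∈ Finset.univ.erase b, (if a ∈ S then g a else f a)
              ((π * Equiv.swap (fstPos b) (sndPos b)) (fstPos a))
              ((π * Equiv.swap (fstPos b) (sndPos b)) (sndPos a)) =
            ∏ a ∈ Finset.univ.erase b,
              (if a ∈ S then g a else f a) (π (fstPos a)) (π (sndPos a)) := by
          refine Finset.prod_congr rfl fun a ha => ?_
          have hab := (Finset.mem_erase.mp ha).1
          rw [Equiv.Perm.mul_apply, Equiv.Perm.mul_apply,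
            Equiv.swap_apply_of_ne_of_ne (fstPos_injective.ne hab) (fstPos_ne_sndPos a b),
            Equiv.swap_apply_of_ne_of_ne (fstPos_ne_sndPos b a).symm (sndPos_injective.ne hab)]
        simp only [hΦ]
        rw [h4]
        simp only [Equiv.Perm.mul_apply, Equiv.swap_apply_left, Equiv.swap_apply_right]
        have h5 := hfg b (π (fstPos b)) (π (sndPos b)) (π.injective.ne (fstPos_ne_sndPos b b))
        rw [← neg_mul]
        congr 1
        linear_combination h5
      have h6 : ∑ π, Φ π = -∑ π, Φ π := by
        rw [← Finset.sum_neg_distrib,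
          ← Equiv.sum_comp (Equiv.mulRight (Equiv.swap (fstPos b) (sndPos b))) Φ]
        exact Finset.sum_congr rfl fun π _ => h3 π
      exact self_eq_neg.mp h6
  rw [key Finset.univ]
  simp

/-! ### The specialization at `-1` -/

theorem pow_exc {R : Type*} [CommMonoid R] {n : ℕ} (s : R) (π : Equiv.Perm (Fin n)) :
    s ^ exc π = ∏ i, if i < π i then s else 1 := by
  rw [exc, ← Finset.prod_filter, Finset.prod_const]

theorem neg_one_pow_maj {R : Type*} [CommRing R] {n : ℕ} (π : Equiv.Perm (Fin n)) :
    (-1 : R) ^ maj π = ∏ i, if i ∈ descents π then (-1) ^ ((i : ℕ) + 1) else 1 := by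
  rw [maj, ← Finset.prod_pow_eq_pow_sum]
  simp

theorem qEulerianAt_neg_one (n : ℕ) :
    qEulerianAt n (-1) = ∑ π : Equiv.Perm (Fin n), (-X) ^ exc π * (-1) ^ maj π := by
  rw [qEulerianAt, qEulerian, Polynomial.map_sum]
  refine Finset.sum_congr rfl fun π _ => ?_
  obtain ⟨k, hk⟩ := Nat.exists_eq_add_of_le (exc_le_maj π)
  rw [hk, Nat.add_sub_cancel_left, neg_pow (X : ℤ[X]), pow_add]
  have h : ((-1 : ℤ[X]) ^ exc π) * (-1) ^ exc π = 1 := by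
    rw [← mul_pow]
    simp
  simp only [Polynomial.map_mul, Polynomial.map_pow, map_X, map_C, coe_evalRingHom,
    eval_X, map_pow, map_neg, map_one]
  linear_combination (-(X : ℤ[X]) ^ exc π * (-1) ^ k) * h

/-- The contribution to `(-t) ^ exc π * (-1) ^ maj π` of the values `x`, `y` at the `a`-th pair of
positions. -/
noncomputable def pairWeight {n : ℕ} (a : Fin (n / 2)) (x y : Fin n) : ℤ[X] :=
  (if fstPos a < x then -X else 1) * (if y < x then -1 else 1) * (if sndPos a < y then -X else 1)

/-- A weight with the same symmetrization as `pairWeight`, which forces `y = sndPos a`. -/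
noncomputable def fixedPairWeight {n : ℕ} (a : Fin (n / 2)) (x y : Fin n) : ℤ[X] :=
  if y = sndPos a then (1 + X) * (if sndPos a < x then X else 1) else 0

/-- If neither value is `sndPos a`, exchanging them keeps the number of excedances in the pair and
flips the sign, so the two terms cancel. Otherwise they add up to `1 + X` or `X + X ^ 2`, according
to whether the other value is smaller or larger. -/
theorem pairWeight_symm {n : ℕ} (a : Fin (n / 2)) (x y : Fin n) (hxy : x ≠ y) :
    pairWeight a x y + pairWeight a y x = fixedPairWeight a x y + fixedPairWeight a y x := by
  have hxy' : (x : ℕ) ≠ y := fun h => hxy (Fin.ext h)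
  simp only [pairWeight, fixedPairWeight, fstPos, sndPos, Fin.lt_def, Fin.ext_iff]
  split_ifs <;> first | omega | ring

theorem neg_X_pow_exc_mul {n : ℕ} (π : Equiv.Perm (Fin n)) :
    (-X : ℤ[X]) ^ exc π * (-1) ^ maj π = ∏ a, pairWeight a (π (fstPos a)) (π (sndPos a)) := by
  rw [pow_exc, neg_one_pow_maj, ← Finset.prod_mul_distrib, prod_eq_prod_pairs]
  · refine Finset.prod_congr rfl fun a _ => ?_
    have h1 : fstPos a ∈ descents π ↔ π (sndPos a) < π (fstPos a) := by
      simp only [descents, Finset.mem_filter, Finset.mem_univ, true_and]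
      exact ⟨fun ⟨_, h⟩ => h, fun h => ⟨(sndPos a).isLt, h⟩⟩
    have h2 : (-1 : ℤ[X]) ^ ((fstPos a : ℕ) + 1) = -1 := Odd.neg_one_pow ⟨a, rfl⟩
    have h3 : (-1 : ℤ[X]) ^ ((sndPos a : ℕ) + 1) = 1 :=
      Even.neg_one_pow ⟨a + 1, by simp only [sndPos]; omega⟩
    rw [h2, h3, ite_self, mul_one, pairWeight]
    simp only [h1]
  · intro i hi
    have h1 : ¬ i < π i := by
      have := (π i).isLt
      rw [Fin.lt_def]
      omega
    have h2 : i ∉ descents π := by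
      simp only [descents, Finset.mem_filter, Finset.mem_univ, true_and]
      rintro ⟨h, -⟩
      omega
    rw [if_neg h1, if_neg h2, mul_one]

theorem prod_fixedPairWeight {n : ℕ} (π : Equiv.Perm (Fin n)) :
    ∏ a, fixedPairWeight a (π (fstPos a)) (π (sndPos a)) =
      if ∀ a, π (sndPos a) = sndPos a then (1 + X) ^ (n / 2) * X ^ exc π else 0 := by
  split_ifs with h
  · rw [pow_exc, prod_eq_prod_pairs (fun i => if i < π i then (X : ℤ[X]) else 1)]
    · have h1 : (1 + X : ℤ[X]) ^ (n / 2) = ∏ _a : Fin (n / 2), (1 + X) := by simp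
      rw [h1, ← Finset.prod_mul_distrib]
      refine Finset.prod_congr rfl fun a _ => ?_
      -- The two thresholds differ only at the value `sndPos a`, already taken by the position
      -- `sndPos a`.
      have h2 : fstPos a < π (fstPos a) ↔ sndPos a < π (fstPos a) := by
        have h3 : π (fstPos a) ≠ sndPos a := by
          intro he
          rw [← h a] at he
          exact fstPos_ne_sndPos a a (π.injective he)
        have h4 : (π (fstPos a) : ℕ) ≠ 2 * a + 1 := fun he => h3 (Fin.ext he)
        simp only [Fin.lt_def]
        change 2 * (a : ℕ) < _ ↔ 2 * (a : ℕ) + 1 < _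
        omega
      simp [fixedPairWeight, h a, h2]
    · intro i hi
      refine if_neg ?_
      have := (π i).isLt
      rw [Fin.lt_def]
      omega
  · push Not at h
    obtain ⟨a, ha⟩ := h
    exact Finset.prod_eq_zero (Finset.mem_univ a) (by simp [fixedPairWeight, ha])

/-! ### Permutations fixing the odd zero-based positions -/

/-- The even elements of `Fin n`. -/
def evenEquiv (n : ℕ) : Fin ((n + 1) / 2) ≃ {i : Fin n // Even (i : ℕ)} where
  toFun j := ⟨⟨2 * j, by omega⟩, even_two_mul _⟩
  invFun i := ⟨(i : ℕ) / 2, by have := i.1.isLt; have := Nat.even_iff.mp i.2; omega⟩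
  left_inv j := by
    ext
    simp
  right_inv i := by
    ext
    have := Nat.even_iff.mp i.2
    simp only
    omega

theorem forall_sndPos_iff {n : ℕ} (π : Equiv.Perm (Fin n)) :
    (∀ a, π (sndPos a) = sndPos a) ↔ ∀ i : Fin n, ¬ Even (i : ℕ) → π i = i := by
  constructor
  · intro h i hi
    rw [Nat.not_even_iff] at hi
    have hin := i.isLt
    have he : i = sndPos ⟨(i : ℕ) / 2, by omega⟩ := by
      ext
      simp only [sndPos]
      omega
    rw [he]
    exact h _
  · intro h a
    apply h
    simp [sndPos]

/-- The map `j ↦ 2 * j` is strictly increasing, and fixed points are not excedances. -/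
theorem exc_extendDomain (n : ℕ) (σ : Equiv.Perm (Fin ((n + 1) / 2))) :
    exc (σ.extendDomain (evenEquiv n)) = exc σ := by
  symm
  rw [exc, exc]
  refine Finset.card_bij (fun j _ => (evenEquiv n j : Fin n)) ?_ ?_ ?_
  · intro j hj
    simp only [Finset.mem_filter, Finset.mem_univ, true_and] at hj ⊢
    rw [Equiv.Perm.extendDomain_apply_image]
    simp only [evenEquiv, Equiv.coe_fn_mk, Fin.lt_def] at hj ⊢
    omega
  · intro i _ j _ h
    exact (evenEquiv n).injective (Subtype.ext h)
  · intro i hi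
    simp only [Finset.mem_filter, Finset.mem_univ, true_and] at hi
    by_cases he : Even (i : ℕ)
    · obtain ⟨j, hj⟩ := (evenEquiv n).surjective ⟨i, he⟩
      have hj' : (evenEquiv n j : Fin n) = i := congrArg Subtype.val hj
      subst hj'
      refine ⟨j, ?_, rfl⟩
      rw [Equiv.Perm.extendDomain_apply_image] at hi
      simp only [Finset.mem_filter, Finset.mem_univ, true_and]
      simp only [evenEquiv, Equiv.coe_fn_mk, Fin.lt_def] at hi ⊢
      omega
    · rw [Equiv.Perm.extendDomain_apply_not_subtype _ (evenEquiv n) (b := i) he] at hi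
      exact absurd hi (lt_irrefl _)

theorem sum_fixing_odd (n : ℕ) :
    ∑ π : Equiv.Perm (Fin n) with (∀ i : Fin n, ¬ Even (i : ℕ) → π i = i), (X : ℤ[X]) ^ exc π =
      excPoly ((n + 1) / 2) := by
  symm
  rw [excPoly]
  refine Finset.sum_bij (fun σ _ => σ.extendDomain (evenEquiv n)) ?_ ?_ ?_ ?_
  · intro σ _
    simp only [Finset.mem_filter, Finset.mem_univ, true_and]
    exact fun i hi => Equiv.Perm.extendDomain_apply_not_subtype _ _ hi
  · intro σ _ τ _ h
    exact Equiv.Perm.extendDomainHom_injective (evenEquiv n) h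
  · intro π hπ
    simp only [Finset.mem_filter, Finset.mem_univ, true_and] at hπ
    -- The preimage of `π` is its restriction `ρ` to the even positions, relabelled through
    -- `evenEquiv`.
    set ρ := (Equiv.Perm.subtypeEquivSubtypePerm fun i : Fin n => Even (i : ℕ)).symm ⟨π, hπ⟩
      with hρ
    refine ⟨(evenEquiv n).permCongr.symm ρ, Finset.mem_univ _, ?_⟩
    have h1 : Equiv.Perm.ofSubtype ρ = π :=
      congrArg Subtype.val
        ((Equiv.Perm.subtypeEquivSubtypePerm fun i : Fin n => Even (i : ℕ)).apply_symm_apply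
          ⟨π, hπ⟩)
    rw [← h1]
    ext i
    by_cases he : Even (i : ℕ)
    · rw [Equiv.Perm.extendDomain_apply_subtype _ (evenEquiv n) (b := i) he, Equiv.Perm.ofSubtype_apply_of_mem (a := i) ρ he]
      simp [Equiv.permCongr_def]
    · rw [Equiv.Perm.extendDomain_apply_not_subtype _ (evenEquiv n) (b := i) he,
        Equiv.Perm.ofSubtype_apply_of_not_mem (a := i) ρ he]
  · intro σ _
    rw [exc_extendDomain]

theorem qEulerianAt_neg_one_eq (n : ℕ) :
    qEulerianAt n (-1) = (1 + X) ^ (n / 2) * eulerian ((n + 1) / 2) := by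
  rw [qEulerianAt_neg_one]
  simp only [neg_X_pow_exc_mul]
  rw [sum_perm_prod_pairs_congr _ _ pairWeight_symm]
  simp only [prod_fixedPairWeight, forall_sndPos_iff]
  rw [← Finset.sum_filter, ← Finset.mul_sum, sum_fixing_odd, excPoly_eq_eulerian]

end SignBalance

theorem theorem2p2 (n : ℕ) (hn : 1 ≤ n) (m : ℕ) :
    (n = 2 * m →
      SignBalance.qEulerianAt n (-1) = (1 + Polynomial.X) ^ m * SignBalance.eulerian m) ∧
    (n = 2 * m + 1 →
      SignBalance.qEulerianAt n (-1) = (1 + Polynomial.X) ^ m * SignBalance.eulerian (m + 1)) := by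
  constructor
  · rintro rfl
    rw [SignBalance.qEulerianAt_neg_one_eq, show 2 * m / 2 = m by omega,
      show (2 * m + 1) / 2 = m by omega]
  · rintro rfl
    rw [SignBalance.qEulerianAt_neg_one_eq, show (2 * m + 1) / 2 = m by omega,
      show (2 * m + 1 + 1) / 2 = m + 1 by omega]
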